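/- Let $k$ be a field of characteristic different from $2$. For every $n\ge 0$, let $\mathrm{DET}_n\in k[x_{i,j}\mid 1\le i,j\le n]$ denote the formal determinant of the $n\times n$ matrix $(x_{i,j})$ of independent indeterminates. Then there is a symmetric matrix $M$ of dimension $(4n^3+7)\times(4n^3+7)$, with entries in $\{x_{i,j}\mid 1\le i,j\le n\}\cup\{0,1,-1,1/2\}$, such that $\mathrm{DET}_n=\det M$. -/

import Mathlib

open Matrix Polynomial

/-! `A.det` is the coefficient of `X ^ n` in `det (1 + X A)`. Turning on the rows of `X A` one at a
time, Cramer's rule links consecutive partial determinants, giving a linear system of size `n ^ 2 +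
1` over `K[X]` with coefficients 0, 1 and `X * A u w` (`system_mulVec_systemSol`). Comparing
coefficients up to degree `n` turns `X` into a shift and gives `L y = a` of size `(n ^ 2 + 1) * (n +
1)` with `det L = 1`, where `± A.det` is an entry of `y`. Bordering the symmetrization of `L` yields
`± 2 (b ⬝ᵥ y)` (`det_borderedSymm`); the entry `1/2` in `b` cancels the 2. -/

theorem exists_symm_fin_of_det_eq_or_neg {R ι : Type*} [CommRing R] [Fintype ι] [DecidableEq ι]
    {S : Set R} (h0 : (0 : R) ∈ S) (h1 : (1 : R) ∈ S) (hneg : (-1 : R) ∈ S)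
    (N : Matrix ι ι R) (hN : N.IsSymm) (hS : ∀ a b, N a b ∈ S) {P : R}
    (hdet : N.det = P ∨ N.det = -P) {m : ℕ} (hm : Fintype.card ι < m) :
    ∃ M : Matrix (Fin m) (Fin m) R, M.IsSymm ∧ (∀ a b, M a b ∈ S) ∧ P = M.det := by
  obtain ⟨s, hs, hsP⟩ : ∃ s ∈ S, N.det * s = P := by
    rcases hdet with h | h
    · exact ⟨1, h1, by rw [h, mul_one]⟩
    · exact ⟨-1, hneg, by rw [h, neg_mul_neg, mul_one]⟩
  obtain ⟨r, rfl⟩ : ∃ r, m = Fintype.card ι + (r + 1) := ⟨m - Fintype.card ι - 1, by omega⟩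
  -- The padding block corrects the sign with its first diagonal entry; this is why the size
  -- inequality is strict.
  let d : Fin (r + 1) → R := Fin.cons s fun _ => 1
  have hd : ∀ i, d i ∈ S := Fin.cases hs fun _ => h1
  have hdS : ∀ i j, diagonal d i j ∈ S := fun i j => by
    rw [diagonal_apply]; split_ifs
    exacts [hd i, h0]
  let e : ι ⊕ Fin (r + 1) ≃ Fin (Fintype.card ι + (r + 1)) :=
    Fintype.equivFinOfCardEq (by simp)
  refine ⟨reindex e e (fromBlocks N 0 0 (diagonal d)), ?_, ?_, ?_⟩
  · exact (hN.fromBlocks (by simp) (isSymm_diagonal d)).submatrix _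
  · intro a b
    rw [reindex_apply, submatrix_apply]
    rcases e.symm a with i | i <;> rcases e.symm b with j | j
    exacts [hS i j, h0, h0, hdS i j]
  · rw [det_reindex_self, det_fromBlocks_zero₂₁, det_diagonal, Fin.prod_univ_succ]
    simp [d, hsP]

/-- The matrix `L` made symmetric, bordered by the vectors `a` and `b`. -/
def borderedSymm {R ι : Type*} [Zero R] (L : Matrix ι ι R) (a b : ι → R) :
    Matrix ((ι ⊕ ι) ⊕ Unit) ((ι ⊕ ι) ⊕ Unit) R :=
  fromBlocks (fromBlocks 0 L Lᵀ 0) (replicateCol Unit (Sum.elim a b))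
    (replicateRow Unit (Sum.elim a b)) 0

theorem borderedSymm_isSymm {R ι : Type*} [Zero R] (L : Matrix ι ι R) (a b : ι → R) :
    (borderedSymm L a b).IsSymm :=
  (IsSymm.fromBlocks (by simp [IsSymm]) rfl (by simp [IsSymm])).fromBlocks
    (by simp) (by simp [IsSymm])

/-- With `S` the symmetrization of `L` and `u = (a, b)`, the Schur complement gives `-det S * (u ⬝ᵥ
S⁻¹ u)`. Here `det S = ±1`, and the two halves of the pairing agree by transposition, whence the
factor 2. -/
theorem det_borderedSymm {R ι : Type*} [CommRing R] [IsDomain R] [Fintype ι] [DecidableEq ι]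
    (L : Matrix ι ι R) (hL : L.det = 1) (a b y : ι → R) (hy : L *ᵥ y = a) :
    (borderedSymm L a b).det = 2 * (b ⬝ᵥ y) ∨ (borderedSymm L a b).det = -(2 * (b ⬝ᵥ y)) := by
  set S : Matrix (ι ⊕ ι) (ι ⊕ ι) R := fromBlocks 0 L Lᵀ 0 with hS
  set u : ι ⊕ ι → R := Sum.elim a b with hu
  have hdet : S.det * S.det = 1 := by
    rw [← det_mul, hS, fromBlocks_multiply]
    simp [hL]
  obtain ⟨z, hz⟩ : ∃ z, Lᵀ *ᵥ z = b := ⟨Lᵀ⁻¹ *ᵥ b, by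
    rw [mulVec_mulVec, mul_nonsing_inv _ (by simp [hL]), one_mulVec]⟩
  have hSz : S *ᵥ Sum.elim z y = u := by
    rw [hS, fromBlocks_mulVec]
    simp [hy, hz, hu]
  have huz : u ⬝ᵥ Sum.elim z y = 2 * (b ⬝ᵥ y) := by
    have : a ⬝ᵥ z = b ⬝ᵥ y := by
      rw [← hy, ← hz, dotProduct_comm, dotProduct_mulVec, mulVec_transpose]
    rw [hu, sumElim_dotProduct_sumElim, this, two_mul]
  -- A column operation clears the border column, since `S *ᵥ (z, y) = u`.
  have key : borderedSymm L a b * fromBlocks 1 (replicateCol Unit (-Sum.elim z y)) 0 1 =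
      fromBlocks S 0 (replicateRow Unit u) (of fun _ _ => -(2 * (b ⬝ᵥ y))) := by
    rw [borderedSymm, fromBlocks_multiply, ← replicateCol_mulVec]
    congr 1
    · simp [hS]
    · ext i j
      simp [mulVec_neg, ← hS, ← hu, hSz]
    · simp [hu]
    · ext i j
      rw [← huz]
      simp [Matrix.mul_apply, dotProduct, hu]
  have := congrArg det key
  rw [det_mul, det_fromBlocks_zero₂₁, det_fromBlocks_zero₁₂] at this
  rw [det_one, det_one, mul_one, mul_one, det_unique (of _), of_apply] at this
  rw [this]
  rcases mul_self_eq_one_iff.1 hdet with h | h <;> simp [h]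

theorem det_eq_one_of_unipotent {R ι α : Type*} [CommRing R] [Fintype ι] [DecidableEq ι]
    [LinearOrder α] (b : ι → α) (L : Matrix ι ι R)
    (h : ∀ i j, b i ≤ b j → L i j = (1 : Matrix ι ι R) i j) : L.det = 1 := by
  have hT : L.BlockTriangular (OrderDual.toDual ∘ b) := fun i j hij => by
    have hij : b i < b j := hij
    rw [h i j hij.le, one_apply_ne]
    rintro rfl
    exact hij.false
  rw [hT.det]
  refine Finset.prod_eq_one fun k _ => ?_
  have : L.toSquareBlock (OrderDual.toDual ∘ b) k = 1 := by
    ext ⟨i, hi⟩ ⟨j, hj⟩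
    have : b i ≤ b j := (OrderDual.toDual.injective (hi.trans hj.symm)).le
    rw [toSquareBlock_def, of_apply, h i j this]
    simp [one_apply]
  rw [this, det_one]

section System

variable {K : Type*} [CommRing K] {n : ℕ} (A : Matrix (Fin n) (Fin n) K)

/-- The matrix `1 + X A` with the rows from `k` on replaced by those of the identity. -/
noncomputable def partialOneAdd (k : ℕ) : Matrix (Fin n) (Fin n) K[X] :=
  of fun u w => (1 : Matrix (Fin n) (Fin n) K[X]) u w + if u.val < k then X * C (A u w) else 0

theorem partialOneAdd_zero : partialOneAdd A 0 = 1 := by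
  ext1 u w
  simp [partialOneAdd]

/-- Replacing row `h` by the basis vector, as the adjugate does, switches off the last active row.
This is the link from one partial determinant to the next. -/
theorem adjugate_partialOneAdd_diag (h : Fin n) :
    (partialOneAdd A (h + 1)).adjugate h h = (partialOneAdd A h).det := by
  rw [adjugate_apply]
  congr 1
  ext1 u w
  rw [updateRow_apply]
  split_ifs with huh
  · subst huh
    simp [partialOneAdd, one_apply, Pi.single_apply, eq_comm]
  · have : u.val < h.val + 1 ↔ u.val < h.val := by
      have := Fin.val_ne_iff.2 huh
      omega
    simp only [partialOneAdd, of_apply, this]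

theorem coeff_det_partialOneAdd : (partialOneAdd A n).det.coeff n = A.det := by
  have : partialOneAdd A n = (X : K[X]) • A.map C + (1 : Matrix (Fin n) (Fin n) K).map C := by
    ext1 u w
    simp [partialOneAdd, one_apply, add_comm]
  rw [this]
  simpa using coeff_det_X_add_C_card A 1

/-- The node of the elimination system that carries the `k`-th partial determinant. -/
def pivotNode (n k : ℕ) : Option (Fin n × Fin n) :=
  if h : k < n then some (⟨k, h⟩, ⟨k, h⟩) else none

/-- The constant part of the elimination system. -/
def systemConst (K : Type*) [CommRing K] (n : ℕ) :
    Matrix (Option (Fin n × Fin n)) (Option (Fin n × Fin n)) K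
  | none, w => if w = pivotNode n 0 then 1 else 0
  | some (h, u), w => if w = some (h, u) ∨ (u = h ∧ w = pivotNode n (h + 1)) then 1 else 0

/-- The linear part of the elimination system. -/
def systemLin : Matrix (Option (Fin n × Fin n)) (Option (Fin n × Fin n)) K
  | some (h, u), some (h', w) => if h' = h ∧ u ≤ h then A u w else 0
  | _, _ => 0

/-- The solution of the elimination system. -/
noncomputable def systemSol : Option (Fin n × Fin n) → K[X]
  | none => (-1) ^ n * (partialOneAdd A n).det
  | some (h, w) => (-1) ^ (h : ℕ) * (partialOneAdd A (h + 1)).adjugate w h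

theorem systemSol_pivotNode {k : ℕ} (hk : k ≤ n) :
    systemSol A (pivotNode n k) = (-1) ^ k * (partialOneAdd A k).det := by
  rcases hk.lt_or_eq with h | rfl
  · simpa [pivotNode, h, systemSol] using
      congrArg ((-1) ^ k * ·) (adjugate_partialOneAdd_diag A ⟨k, h⟩)
  · simp [pivotNode, systemSol]

theorem pivotNode_succ_ne (h u : Fin n) : pivotNode n (h + 1) ≠ some (h, u) := by
  unfold pivotNode
  split_ifs <;> simp [Fin.ext_iff]

/-- Row `(h, u)` is entry `(u, h)` of `P * adjugate P = det P • 1` for `P = partialOneAdd A (h +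
1)`. The alternating signs in `systemSol` let `det P` enter with coefficient `+1`, so no `-A u w` is
needed. -/
theorem system_mulVec_systemSol :
    ((systemConst K n).map C + (X : K[X]) • (systemLin A).map C) *ᵥ systemSol A =
      Pi.single none 1 := by
  ext1 v
  rcases v with _ | ⟨h, u⟩
  · have : ∀ w, ((systemConst K n).map C + (X : K[X]) • (systemLin A).map C) none w =
        if w = pivotNode n 0 then 1 else 0 := fun w => by
      simp [systemConst, systemLin, apply_ite C]
    simp [mulVec, dotProduct, this, systemSol_pivotNode, partialOneAdd_zero]
  · have : ∀ w, ((systemConst K n).map C + (X : K[X]) • (systemLin A).map C) (some (h, u)) w =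
        w.elim 0 (fun p => if p.1 = h then partialOneAdd A (h + 1) u p.2 else 0) +
          if w = pivotNode n (h + 1) then (if u = h then 1 else 0) else 0 := fun w => by
      rcases w with _ | ⟨h', w⟩
      · by_cases hu : u = h <;> simp [systemConst, systemLin, hu, apply_ite C]
      · by_cases hw : some (h', w) = pivotNode n (h + 1)
        · have hh : h' ≠ h := by
            rintro rfl
            exact pivotNode_succ_ne h' w hw.symm
          simp [systemConst, systemLin, ← hw, hh, apply_ite C]
        · by_cases hh : h' = h
          · subst hh
            have hwu : w = u ↔ u = w := eq_comm
            simp [systemConst, systemLin, hw, partialOneAdd, one_apply, apply_ite C, hwu]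
          · simp [systemConst, systemLin, hw, hh]
    have hsum : ∑ w, w.elim 0 (fun p : Fin n × Fin n => if p.1 = h then
        partialOneAdd A (h + 1) u p.2 else 0) * systemSol A w =
          (-1) ^ (h : ℕ) * if u = h then (partialOneAdd A (h + 1)).det else 0 := by
      have hadj := congrFun (congrFun (mul_adjugate (partialOneAdd A (h + 1))) u) h
      rw [Matrix.mul_apply, Matrix.smul_apply, one_apply, smul_eq_mul, mul_ite, mul_one,
        mul_zero] at hadj
      rw [Fintype.sum_option, Fintype.sum_prod_type, Finset.sum_eq_single h]
      · simp only [systemSol, Option.elim, if_true, zero_mul, zero_add, ← hadj, Finset.mul_sum]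
        exact Finset.sum_congr rfl fun _ _ => by ring
      · intro h' _ hh
        simp [hh]
      · simp
    simp only [mulVec, dotProduct, this, add_mul, Finset.sum_add_distrib, hsum, ite_mul, zero_mul,
      Finset.sum_ite_eq', Finset.mem_univ, if_true, systemSol_pivotNode A h.isLt]
    by_cases hu : u = h <;> simp [hu, pow_succ]

/-- The equation of the elimination system attached to a node. -/
def nodeEquation : Option (Fin n × Fin n) → Option (Fin n × Fin n)
  | none => if n = 0 then none else pivotNode n (n - 1)
  | some (h, u) => if u = h then if h.val = 0 then none else pivotNode n (h - 1) else some (h, u)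

/-- A rank for which the constant part of the row-permuted system is unipotent. -/
def nodeRank : Option (Fin n × Fin n) → ℕ
  | none => n
  | some (h, u) => if u = h then h else 0

/-- The constant part only ties pivot `k` to pivot `k + 1`. Assigning that equation to pivot `k + 1`
leaves the lower-ranked pivot `k` as its sole off-diagonal term. -/
theorem systemConst_nodeEquation (v w : Option (Fin n × Fin n)) (h : nodeRank v ≤ nodeRank w) :
    systemConst K n (nodeEquation v) w = (1 : Matrix _ _ K) v w := by
  rcases v with _ | ⟨⟨a, ha⟩, ⟨b, hb⟩⟩ <;> rcases w with _ | ⟨⟨c, hc⟩, ⟨d, hd⟩⟩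
  all_goals
    simp only [nodeEquation, nodeRank, pivotNode, one_apply, Fin.mk.injEq] at h ⊢
    split_ifs at h ⊢ <;> simp_all [systemConst, pivotNode] <;> grind

/-- The elimination system with the indeterminate replaced by a shift. -/
def shiftSystem : Matrix (Option (Fin n × Fin n) × Fin (n + 1))
    (Option (Fin n × Fin n) × Fin (n + 1)) K :=
  fun p q => if q.2 = p.2 then systemConst K n (nodeEquation p.1) q.1
    else if q.2.val + 1 = p.2 then systemLin A (nodeEquation p.1) q.1 else 0

theorem det_shiftSystem : (shiftSystem A).det = 1 := by
  -- The linear part strictly lowers the degree index; within one degree `nodeRank` decides.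
  refine det_eq_one_of_unipotent (fun p => toLex (p.2, nodeRank p.1)) _ ?_
  rintro ⟨v, i⟩ ⟨w, j⟩ hle
  rw [Prod.Lex.toLex_le_toLex] at hle
  simp only [shiftSystem]
  rcases hle with hlt | ⟨heq, hle⟩
  · have hlt : i < j := hlt
    rw [if_neg hlt.ne', if_neg (by have := Fin.lt_def.1 hlt; omega), one_apply_ne]
    simp [hlt.ne]
  · have heq : i = j := heq
    subst heq
    rw [if_pos rfl, systemConst_nodeEquation v w hle]
    simp [one_apply]

/-- Truncating at degree `n` loses nothing: the coefficient of degree `i` in the system involves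
only those of degrees `i` and `i - 1` of the solution. -/
theorem shiftSystem_mulVec :
    (shiftSystem A *ᵥ fun q => (systemSol A q.1).coeff q.2) =
      fun p => if nodeEquation p.1 = none ∧ p.2 = 0 then 1 else 0 := by
  ext ⟨v, i⟩
  have h := congrArg (fun f : K[X] => f.coeff i)
    (congrFun (system_mulVec_systemSol A) (nodeEquation v))
  simp only [mulVec, dotProduct, Matrix.add_apply, Matrix.smul_apply, map_apply, add_mul,
    finsetSum_coeff, coeff_add, coeff_C_mul, smul_eq_mul, mul_assoc] at h
  have hrow : ∀ w, ∑ j, shiftSystem A (v, i) (w, j) * (systemSol A w).coeff j =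
      systemConst K n (nodeEquation v) w * (systemSol A w).coeff i +
        (X * (C (systemLin A (nodeEquation v) w) * systemSol A w)).coeff i := by
    intro w
    have hsplit : ∀ j, shiftSystem A (v, i) (w, j) * (systemSol A w).coeff j =
        (if j = i then systemConst K n (nodeEquation v) w * (systemSol A w).coeff j else 0) +
          if j.val + 1 = i then systemLin A (nodeEquation v) w * (systemSol A w).coeff j
          else 0 := by
      intro j
      simp only [shiftSystem]
      by_cases hj : j = i
      · simp [hj]
      · simp [hj]
    simp only [hsplit, Finset.sum_add_distrib, Finset.sum_ite_eq', Finset.mem_univ, if_true]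
    congr 1
    rcases i with ⟨_ | i, hi⟩
    · simp
    · rw [Finset.sum_eq_single ⟨i, by omega⟩]
      · simp [coeff_X_mul]
      · intro j _ hj
        rw [if_neg]
        simpa [Fin.ext_iff] using hj
      · simp
  simp only [mulVec, dotProduct, Fintype.sum_prod_type, hrow]
  rw [h]
  by_cases hv : nodeEquation v = none
  · rw [hv, Pi.single_eq_same, coeff_one]
    simp only [true_and, Fin.ext_iff, Fin.val_zero]
  · simp [hv]

end System

theorem card_bound (n : ℕ) : 2 * ((n * n + 1) * (n + 1)) + 1 < 4 * n ^ 3 + 7 := by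
  rcases n with _ | n
  · norm_num
  · nlinarith [sq_nonneg n, mul_nonneg (Nat.zero_le n) (sq_nonneg n)]

theorem mainTheorem5 {k : Type*} [Field k] (hk : ringChar k ≠ 2) (n : ℕ) :
    ∃ M : Matrix (Fin (4 * n ^ 3 + 7)) (Fin (4 * n ^ 3 + 7)) (MvPolynomial (Fin n × Fin n) k),
      M.IsSymm ∧
      (∀ a b, M a b ∈ Set.range (MvPolynomial.X : Fin n × Fin n → MvPolynomial (Fin n × Fin n) k) ∪
        {0, 1, -1, MvPolynomial.C (1 / 2 : k)}) ∧
      (Matrix.mvPolynomialX (Fin n) (Fin n) k).det = M.det := by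
  set S : Set (MvPolynomial (Fin n × Fin n) k) :=
    Set.range MvPolynomial.X ∪ {0, 1, -1, MvPolynomial.C (1 / 2 : k)} with hS
  have h0 : 0 ∈ S := by simp [hS]
  have h1 : 1 ∈ S := by simp [hS]
  have hhalf : MvPolynomial.C (1 / 2 : k) ∈ S := by simp [hS]
  set A := Matrix.mvPolynomialX (Fin n) (Fin n) k with hA
  have hL : ∀ p q, shiftSystem A p q ∈ S := by
    have hc : ∀ v w, systemConst (MvPolynomial (Fin n × Fin n) k) n v w ∈ S := by
      rintro (_ | ⟨h, u⟩) w <;> simp only [systemConst] <;> split_ifs <;> assumption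
    have hl : ∀ v w, systemLin A v w ∈ S := by
      rintro (_ | ⟨h, u⟩) (_ | ⟨h', w⟩) <;> simp only [systemLin] <;> try exact h0
      split_ifs
      · exact Or.inl ⟨(u, w), rfl⟩
      · exact h0
    intro p q
    unfold shiftSystem
    split_ifs
    exacts [hc _ _, hl _ _, h0]
  set a : Option (Fin n × Fin n) × Fin (n + 1) → MvPolynomial (Fin n × Fin n) k :=
    fun p => if nodeEquation p.1 = none ∧ p.2 = 0 then 1 else 0 with ha
  -- `b` selects the top coefficient of the last partial determinant, halved.
  set b : Option (Fin n × Fin n) × Fin (n + 1) → MvPolynomial (Fin n × Fin n) k :=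
    Pi.single (none, Fin.last n) (MvPolynomial.C (1 / 2)) with hb
  have hab : ∀ p, Sum.elim a b p ∈ S := by
    rintro (p | p)
    · simp only [ha, Sum.elim_inl]
      split_ifs <;> assumption
    · simp only [hb, Sum.elim_inr, Pi.single_apply]
      split_ifs <;> assumption
  refine exists_symm_fin_of_det_eq_or_neg h0 h1 (by simp [hS])
    (borderedSymm (shiftSystem A) a b) (borderedSymm_isSymm _ _ _) ?_ ?_ ?_
  · rintro ((p | p) | p) ((q | q) | q)
    exacts [h0, hL p q, hab (.inl p), hL q p, h0, hab (.inr p), hab (.inl q), hab (.inr q), h0]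
  · have h2 : (2 : k) ≠ 0 := Ring.two_ne_zero hk
    have hC : (2 : MvPolynomial (Fin n × Fin n) k) * MvPolynomial.C (1 / 2) = 1 := by
      rw [show (2 : MvPolynomial (Fin n × Fin n) k) = MvPolynomial.C 2 from (map_ofNat _ 2).symm, ← map_mul,
        mul_one_div_cancel h2, map_one]
    have hval : 2 * (b ⬝ᵥ fun q => (systemSol A q.1).coeff q.2) = (-1) ^ n * A.det := by
      rw [hb, single_dotProduct, ← mul_assoc, hC, one_mul, ← coeff_det_partialOneAdd]
      have : ((-1 : (MvPolynomial (Fin n × Fin n) k)[X]) ^ n) = C ((-1) ^ n) := by simp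
      rw [systemSol, this, coeff_C_mul, Fin.val_last]
    have := det_borderedSymm (shiftSystem A) (det_shiftSystem A) a b _ (shiftSystem_mulVec A)
    rw [hval] at this
    rcases neg_one_pow_eq_or (MvPolynomial (Fin n × Fin n) k) n with h | h <;>
      simpa [h, or_comm] using this
  · simpa [two_mul] using card_bound n
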